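/- Let $C$ be an integral domain and let $\lambda\in C$ be non-zero. A Baxter $C$-algebra of weight $\lambda$ is a commutative $C$-algebra $R$ with a $C$-linear map $P:R\to R$ such that $P(x)P(y)=P(xP(y))+P(yP(x))+\lambda P(xy)$; homomorphisms are $C$-algebra homomorphisms commuting with the operators. For a commutative $C$-algebra $A$, the shuffle Baxter algebra is $\mathrm{Sh}_C(A)=\bigoplus_{k\ge 0}A^{\otimes(k+1)}$, with operator $P_A(x_0\otimes\cdots\otimes x_n)=1\otimes x_0\otimes\cdots\otimes x_n$ and with the mixable shuffle product $$(x_0\otimes\cdots\otimes x_m)\diamond(y_0\otimes\cdots\otimes y_n)=\sum_{(\sigma,T)}\lambda^{|T|}\,x_0y_0\otimes\sigma(x_1\otimes\cdots\otimes x_m\otimes y_1\otimes\cdots\otimes y_n;T),$$ where $\sigma$ runs over the $(m,n)$-shuffles in $S_{m+n}$ (that is, $\sigma^{-1}$ is increasing on $\{1,\dots,m\}$ and on $\{m+1,\dots,m+n\}$), $T$ runs over the sets of pairs $(k,k+1)$ with $\sigma(k)\le m<\sigma(k+1)$, and $\sigma(u_1\otimes\cdots\otimes u_{m+n};T)$ is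 $u_{\sigma(1)}\otimes\cdots\otimes u_{\sigma(m+n)}$ with the factors $u_{\sigma(k)}$ and $u_{\sigma(k+1)}$ multiplied together for each $(k,k+1)\in T$. Its completion is $\widehat{\mathrm{Sh}}_C(A)=\prod_{k\ge0}A^{\otimes(k+1)}$, with the product and the operator extended by continuity. Let $\overline A=\varinjlim_{n\geq 1} A^{\otimes n}$ be the direct limit of the tensor power algebras along $x\mapsto x\otimes 1$, and let $\mathfrak A(A)=\prod_{n\ge1}\overline A$, with componentwise operations and with the operator $P'_A(a_1,a_2,a_3,\dots)=\lambda(0,a_1,a_1+a_2,\dots)$. For $a\in A$ let $t^{(a)}\in\mathfrak A(A)$ be the sequence with $k$-th component $1\otimes\cdots\otimes1\otimes a\in A^{\otimes k}$, and let $\mathfrak S(A)\subseteq\mathfrak A(A)$ be the Baxter subalgebra (the $C$-subalgebra stable under $P'_A$) generated by all $t^{(a)}$. Take $A=C$. The canonical map $C\to\overline C$ is an isomorphism, by which we identify $\overline C$ with $C$. Every element of $\mathrm{Sh}_C(C)$ can be written uniquely as $\sum_{n\ge0} b_n\mathbf 1^{\otimes(n+1)}$ with $b_n\in C$ almost all zero,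 and every element of $\widehat{\mathrm{Sh}}_C(C)$ can be written uniquely in this form with arbitrary $b_n\in C$. There is a unique homomorphism of Baxter $C$-algebras $\Phi:\mathrm{Sh}_C(C)\to\mathfrak S(C)$ with $\Phi(a)=t^{(a)}$ for all $a\in C$ (where $C$ is the first summand of $\mathrm{Sh}_C(C)$); it is an isomorphism, and $$\Phi\Big(\sum_{n\ge0} b_n\mathbf 1^{\otimes(n+1)}\Big)=\Big(\sum_{i=0}^{n-1}\binom{n-1}{i}\lambda^i b_i\Big)_{n\ge1}.$$ Moreover $\Phi$ extends uniquely to a homomorphism of Baxter algebras $\widehat\Phi:\widehat{\mathrm{Sh}}_C(C)\to\mathfrak A(C)$; it is injective, and it is given by the same formula for arbitrary sequences $(b_n)_{n\ge0}$ in $C$. -/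

import Mathlib

open scoped TensorProduct DirectSum

noncomputable section

namespace FreeBaxter

/-! ### Tensor powers -/

section TensorPower

variable (C : Type*) [CommRing C] (A : Type*) [CommRing A] [Algebra C A]

/-- The tensor power `A^{⊗ n}` over `C`; it is also regarded as a `C`-algebra with the
componentwise multiplication. -/
abbrev TPow (n : ℕ) : Type _ := ⨂[C] (_ : Fin n), A

variable {C A} in
/-- The algebra homomorphism `A^{⊗ m} → A^{⊗ n}` which puts the `i`-th factor into position `f i`.
Factors that are sent to the same position are multiplied, and positions that are not hit are
filled with `1` (see `place_tprod`). -/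
def place {m n : ℕ} (f : Fin m → Fin n) : TPow C A m →ₐ[C] TPow C A n :=
  PiTensorProduct.liftAlgHom
    ((MultilinearMap.mkPiAlgebra C (Fin m) (TPow C A n)).compLinearMap
      fun i => (PiTensorProduct.singleAlgHom (R := C) (A := fun _ : Fin n => A) (f i)).toLinearMap)
    (by simp [Pi.one_def, -PiTensorProduct.singleAlgHom_apply])
    (by
      intro x y
      simp only [MultilinearMap.compLinearMap_apply, MultilinearMap.mkPiAlgebra_apply,
        AlgHom.toLinearMap_apply, Pi.mul_apply, map_mul, Finset.prod_mul_distrib])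

theorem place_tprod {m n : ℕ} (f : Fin m → Fin n) (x : Fin m → A) :
    place f (PiTensorProduct.tprod C x) =
      PiTensorProduct.tprod C (fun j => ∏ i with f i = j, x i) := by
  have h : (fun j => ∏ i with f i = j, x i) =
      ∏ i, (Pi.mulSingle (f i) (x i) : Fin n → A) := by
    funext j
    rw [Finset.prod_apply, Finset.prod_filter]
    refine Finset.prod_congr rfl fun i _ => ?_
    by_cases hj : f i = j
    · subst hj; simp
    · rw [if_neg hj, Pi.mulSingle_eq_of_ne (fun h => hj h.symm)]
  rw [h, PiTensorProduct.tprod_prod]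
  exact (PiTensorProduct.lift.tprod x).trans rfl

end TensorPower

/-! ### Mixable shuffles -/

section Shuffles

/-- `σ ∈ S_{m+n}` is an `(m,n)`-shuffle: `σ⁻¹` is increasing on the first `m` and on the last `n`
indices. -/
def IsShuffle (m n : ℕ) (σ : Equiv.Perm (Fin (m + n))) : Prop :=
  StrictMono (fun i : Fin m => σ⁻¹ (Fin.castAdd n i)) ∧
    StrictMono (fun j : Fin n => σ⁻¹ (Fin.natAdd m j))

/-- The pair `(k, k+1)` is admissible for `σ`: `σ k` is one of the first `m` indices and `σ (k+1)`
one of the last `n`. -/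
def IsAdmissible (m n : ℕ) (σ : Equiv.Perm (Fin (m + n))) (k : Fin (m + n)) : Prop :=
  ∃ h : (k : ℕ) + 1 < m + n, (σ k : ℕ) < m ∧ m ≤ (σ ⟨k + 1, h⟩ : ℕ)

/-- A mixable `(m,n)`-shuffle `(σ, T)`; the pair `(k, k+1)` is encoded by `k`. -/
def MixableShuffle (m n : ℕ) : Type :=
  {s : Equiv.Perm (Fin (m + n)) × Finset (Fin (m + n)) //
    IsShuffle m n s.1 ∧ ∀ k ∈ s.2, IsAdmissible m n s.1 k}

namespace MixableShuffle

variable {m n : ℕ}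

instance : Finite (MixableShuffle m n) := Subtype.finite

instance : Fintype (MixableShuffle m n) := Fintype.ofFinite _

/-- The shuffle `σ`. -/
def perm (s : MixableShuffle m n) : Equiv.Perm (Fin (m + n)) := s.1.1

/-- The set `T` of merged pairs. -/
def merged (s : MixableShuffle m n) : Finset (Fin (m + n)) := s.1.2

theorem block_lt (s : MixableShuffle m n) (p : Fin (m + n)) :
    (p : ℕ) - (s.merged.filter (· < p)).card < m + n - s.merged.card := by
  have h1 : (s.merged.filter (· < p)).card ≤ p := by
    calc (s.merged.filter (· < p)).card ≤ (Finset.Iio p).card :=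
          Finset.card_le_card fun x hx => by simpa using (Finset.mem_filter.1 hx).2
      _ = p := by simp
  have hlast : ∀ k ∈ s.merged, (k : ℕ) + 1 < m + n := fun k hk => (s.2.2 k hk).1
  have h2 : (s.merged.filter (fun k => ¬ k < p)).card ≤ m + n - 1 - p := by
    rw [← Finset.card_map Fin.valEmbedding]
    calc _ ≤ (Finset.Ico (p : ℕ) (m + n - 1)).card := by
          refine Finset.card_le_card fun x hx => ?_
          simp only [Finset.mem_map, Finset.mem_filter, not_lt, Fin.valEmbedding_apply] at hx
          obtain ⟨k, ⟨hk, hpk⟩, rfl⟩ := hx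
          have := hlast k hk
          have : (p : ℕ) ≤ k := hpk
          simp only [Finset.mem_Ico]
          omega
      _ = m + n - 1 - p := by simp
  have h3 := Finset.card_filter_add_card_filter_not (s := s.merged) (fun k => k < p)
  have := p.2
  omega

/-- After the pairs in `T` have been merged, the `p`-th factor of the shuffle stands at position
`p - #{k ∈ T | k < p}` among the remaining `m + n - |T|` positions. -/
def block (s : MixableShuffle m n) (p : Fin (m + n)) : Fin (m + n - s.merged.card) :=
  ⟨p - (s.merged.filter (· < p)).card, s.block_lt p⟩

/-- The position in `x₀ y₀ ⊗ σ(x⁺ ⊗ y⁺; T)` of each factor of `x = x₀ ⊗ x₁ ⊗ ⋯ ⊗ x_m`. -/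
def slotLeft (s : MixableShuffle m n) : Fin (m + 1) → Fin (m + n - s.merged.card + 1) :=
  Fin.cases 0 fun i => (s.block (s.perm⁻¹ (Fin.castAdd n i))).succ

/-- The position in `x₀ y₀ ⊗ σ(x⁺ ⊗ y⁺; T)` of each factor of `y = y₀ ⊗ y₁ ⊗ ⋯ ⊗ y_n`. -/
def slotRight (s : MixableShuffle m n) : Fin (n + 1) → Fin (m + n - s.merged.card + 1) :=
  Fin.cases 0 fun j => (s.block (s.perm⁻¹ (Fin.natAdd m j))).succ

end MixableShuffle

end Shuffles

/-! ### Homomorphisms -/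

/-- `f : (R, P) → (S, Q)` is a homomorphism of Baxter `C`-algebras: `C`-linear, unital,
multiplicative, and compatible with the operators. -/
structure IsBaxterHom {C R S : Type*} [CommRing C] [AddCommGroup R] [Module C R] [Mul R] [One R]
    [AddCommGroup S] [Module C S] [Mul S] [One S]
    (P : R →ₗ[C] R) (Q : S →ₗ[C] S) (f : R →ₗ[C] S) : Prop where
  map_one : f 1 = 1
  map_mul : ∀ x y, f (x * y) = f x * f y
  map_op : ∀ x, f (P x) = Q (f x)

/-! ### The shuffle Baxter algebra and its completion -/

section Shuffle

variable {C : Type*} [CommRing C] (lam : C) (A : Type*) [CommRing A] [Algebra C A]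

/-- The shuffle Baxter algebra `Ш_C(A) = ⨁_{k ≥ 0} A^{⊗ (k+1)}` of weight `lam`. -/
def Sha (lam : C) (A : Type*) [CommRing A] [Algebra C A] : Type _ := ⨁ k : ℕ, TPow C A (k + 1)

namespace Sha

instance : AddCommGroup (Sha lam A) := inferInstanceAs (AddCommGroup (⨁ k : ℕ, TPow C A (k + 1)))

instance : Module C (Sha lam A) := inferInstanceAs (Module C (⨁ k : ℕ, TPow C A (k + 1)))

/-- The inclusion of the summand `A^{⊗ (k+1)}`. -/
def incl (k : ℕ) : TPow C A (k + 1) →ₗ[C] Sha lam A :=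
  DirectSum.lof C ℕ (fun k => TPow C A (k + 1)) k

/-- The projection to the summand `A^{⊗ (k+1)}`. -/
def proj (k : ℕ) : Sha lam A →ₗ[C] TPow C A (k + 1) :=
  DirectSum.component C ℕ (fun k => TPow C A (k + 1)) k

/-- The embedding `j_A : A → Ш_C(A)` as the first summand. -/
def j : A →ₗ[C] Sha lam A :=
  incl lam A 0 ∘ₗ (PiTensorProduct.singleAlgHom (R := C) (A := fun _ : Fin 1 => A) 0).toLinearMap

/-- The mixable shuffle product
`x ⋄ y = ∑_{(σ,T)} lam^|T| x₀ y₀ ⊗ σ(x⁺ ⊗ y⁺; T)` of `A^{⊗ (m+1)}` and `A^{⊗ (n+1)}`. -/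
def mulHom (m n : ℕ) : TPow C A (m + 1) →ₗ[C] TPow C A (n + 1) →ₗ[C] Sha lam A :=
  ∑ s : MixableShuffle m n, lam ^ s.merged.card •
    ((LinearMap.mul C (TPow C A (m + n - s.merged.card + 1))).compl₁₂
      (place s.slotLeft).toLinearMap (place s.slotRight).toLinearMap).compr₂ (incl lam A _)

/-- The mixable shuffle product on `Ш_C(A)`. -/
def mul : Sha lam A →ₗ[C] Sha lam A →ₗ[C] Sha lam A :=
  DirectSum.toModule C ℕ _ fun m =>
    (DirectSum.toModule C ℕ _ fun n => (mulHom lam A m n).flip : Sha lam A →ₗ[C] _).flip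

instance : Mul (Sha lam A) := ⟨fun x y => mul lam A x y⟩

instance : One (Sha lam A) := ⟨j lam A 1⟩

/-- The Baxter operator `P_A (x₀ ⊗ ⋯ ⊗ x_n) = 1 ⊗ x₀ ⊗ ⋯ ⊗ x_n`. -/
def op : Sha lam A →ₗ[C] Sha lam A :=
  DirectSum.toModule C ℕ _ fun n =>
    incl lam A (n + 1) ∘ₗ (place (Fin.succ : Fin (n + 1) → Fin (n + 1 + 1))).toLinearMap

end Sha

/-- The complete shuffle Baxter algebra, as the product `∏_{k ≥ 0} A^{⊗ (k+1)}`. -/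
def ShaHat (lam : C) (A : Type*) [CommRing A] [Algebra C A] : Type _ :=
  (k : ℕ) → TPow C A (k + 1)

namespace ShaHat

instance : AddCommGroup (ShaHat lam A) := inferInstanceAs (AddCommGroup ((k : ℕ) → TPow C A (k + 1)))

instance : Module C (ShaHat lam A) := inferInstanceAs (Module C ((k : ℕ) → TPow C A (k + 1)))

/-- The inclusion `Ш_C(A) → ∏_k A^{⊗ (k+1)}`. -/
def ofSha : Sha lam A →ₗ[C] ShaHat lam A :=
  LinearMap.pi fun k => Sha.proj lam A k

/-- The truncation of a series to its components of degree `≤ k`. -/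
def trunc (k : ℕ) (x : ShaHat lam A) : Sha lam A :=
  ∑ i ∈ Finset.range (k + 1), Sha.incl lam A i (x i)

/-- The continuous extension of the product of `Ш_C(A)`: since the elements without components of
degree `≤ k` form an ideal of `Ш_C(A)`, the component of degree `k` of a product only depends on
the components of degree `≤ k` of the factors. -/
instance : Mul (ShaHat lam A) :=
  ⟨fun x y k => Sha.proj lam A k (trunc lam A k x * trunc lam A k y)⟩

instance : One (ShaHat lam A) := ⟨ofSha lam A 1⟩

/-- The continuous extension of the Baxter operator. -/
def op : ShaHat lam A →ₗ[C] ShaHat lam A :=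
  LinearMap.pi fun k => match k with
    | 0 => 0
    | k + 1 => (place (Fin.succ : Fin (k + 1) → Fin (k + 1 + 1))).toLinearMap ∘ₗ
        (LinearMap.proj k : ((k : ℕ) → TPow C A (k + 1)) →ₗ[C] TPow C A (k + 1))

end ShaHat

end Shuffle

/-! ### The standard Baxter algebra -/

section Standard

variable (C : Type*) [CommRing C] (A : Type*) [CommRing A] [Algebra C A]

/-- The direct limit `Ā` of the algebras `A^{⊗ n}`, `n ≥ 1`, along `x ↦ x ⊗ 1 ⊗ ⋯ ⊗ 1`. -/
def Bar : Type _ :=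
  Ring.DirectLimit (ι := ℕ+) (fun n => TPow C A n)
    (fun m n (h : m ≤ n) => (place (Fin.castLE h) : TPow C A m → TPow C A n))

instance : CommRing (Bar C A) :=
  Ring.instCommRingDirectLimit _ _

/-- The canonical map `A^{⊗ n} → Ā`. -/
def Bar.of (n : ℕ+) : TPow C A n →+* Bar C A :=
  Ring.DirectLimit.of (ι := ℕ+) (fun n => TPow C A n)
    (fun m n (h : m ≤ n) => (place (Fin.castLE h) : TPow C A m → TPow C A n)) n

instance : Algebra C (Bar C A) :=
  ((Bar.of C A 1).comp (algebraMap C (TPow C A ((1 : ℕ+) : ℕ)))).toAlgebra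

/-- The algebra `𝔄(A) = ∏_{n ≥ 1} Ā` of sequences, with the componentwise operations. -/
abbrev StdSeq : Type _ := ℕ+ → Bar C A

variable {C}

/-- The operator `P'_A (a₁, a₂, a₃, …) = lam (0, a₁, a₁ + a₂, …)` on `𝔄(A)`. -/
def stdOp (lam : C) : StdSeq C A →ₗ[C] StdSeq C A :=
  lam • LinearMap.pi fun n => ∑ i ∈ Finset.Iio n, LinearMap.proj i

variable (C) {A} in
/-- The sequence `t^{(a)}`, with `k`-th component `1 ⊗ ⋯ ⊗ 1 ⊗ a ∈ A^{⊗ k}`. -/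
def tSeq (a : A) : StdSeq C A := fun k =>
  Bar.of C A k (PiTensorProduct.tprod C fun i : Fin k => if (i : ℕ) + 1 = k then a else 1)

/-- The standard Baxter algebra `𝔖(A)`: the Baxter subalgebra of `𝔄(A)` generated by the
sequences `t^{(a)}`. -/
def Std (lam : C) : Subalgebra C (StdSeq C A) :=
  sInf {S | (∀ a : A, tSeq C a ∈ S) ∧ ∀ x ∈ S, stdOp A lam x ∈ S}

theorem stdOp_mem (lam : C) : ∀ x ∈ (Std A lam).toSubmodule, stdOp A lam x ∈ (Std A lam).toSubmodule :=
  fun x hx => Algebra.mem_sInf.2 fun S hS => hS.2 x (Algebra.mem_sInf.1 hx S hS)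

theorem tSeq_mem (lam : C) (a : A) : tSeq C a ∈ Std A lam :=
  Algebra.mem_sInf.2 fun _ hS => hS.1 a

/-- The Baxter operator of `𝔖(A)`. -/
def Std.op (lam : C) : Std A lam →ₗ[C] Std A lam :=
  LinearMap.restrict (p := (Std A lam).toSubmodule) (q := (Std A lam).toSubmodule)
    (stdOp A lam) (stdOp_mem A lam)

end Standard

/-! ### The case `A = C` -/

section Base

variable {C : Type*} [CommRing C] (lam : C)

/-- The element `∑_n b_n 1^{⊗ (n+1)}` of `Ш_C(C)`, for `b` of finite support. -/
def shaSum (b : ℕ →₀ C) : Sha lam C :=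
  b.sum fun n c => c • Sha.incl lam C n (PiTensorProduct.tprod C fun _ => 1)

/-- The element `∑_n b_n 1^{⊗ (n+1)}` of the completion, for an arbitrary sequence `b`. -/
def shaHatSum (b : ℕ → C) : ShaHat lam C :=
  fun n => b n • PiTensorProduct.tprod C fun _ => 1

/-- The sequence in `𝔄(C)` with `n`-th component `∑_{i=0}^{n-1} binom(n-1, i) lam^i b_i`, read in
`C̄` through the canonical map `C → C̄`. -/
def binomSeq (b : ℕ → C) : StdSeq C C := fun n =>
  algebraMap C (Bar C C)
    (∑ i ∈ Finset.range n, (((n : ℕ) - 1).choose i : C) * lam ^ i * b i)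

end Base

end FreeBaxter

end

/-!
Since `C^{⊗ n} = C`, the elements of both shuffle algebras are sequences `b` of coefficients. The
element `∑_n b_n 1^{⊗ (n+1)}` and the binomial sequence of `b` obey the same recursion: each of them
is `b₀ · 1` plus the operator applied to the element that belongs to the shifted sequence
`b₁, b₂, …`. So the map between them commutes with the operators. It is injective because
`P'` is injective when `lam` is regular, and it is determined by its value at `1`: on the completion
this holds because the `n`-th component of `P' x` only involves the components of `x` before the
`n`-th.

On the elements `1^{⊗ (m+1)}`, multiplicativity is the identity
`binom(N, m) binom(N, n) = ∑_{(σ,T)} binom(N, m + n - |T|)`. For a shuffle `σ` with `a` admissible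
pairs, the sum over `T` is `binom(N + a, m + n)` by Vandermonde's identity. A shuffle is a word in
two letters, with `a` the number of places where the first letter is followed by the second;
removing the last letter shows that the sum over all words obeys the recursion in `N` which
Pascal's rule gives for `binom(N, m) binom(N, n)`.
-/

noncomputable section

namespace FreeBaxter

open Finset

/-! ### Counting mixable shuffles -/

section Switches

/-- For a word of length `L` in two letters, encoded by the set `S` of the positions of the first
letter, the positions at which the first letter is directly followed by the second one. -/
def switches (L : ℕ) (S : Finset ℕ) : Finset ℕ := {k ∈ S | k + 1 < L ∧ k + 1 ∉ S}

theorem mem_switches {L k : ℕ} {S : Finset ℕ} :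
    k ∈ switches L S ↔ k ∈ S ∧ k + 1 < L ∧ k + 1 ∉ S := mem_filter

theorem switches_insert_last (L : ℕ) (S : Finset ℕ) :
    switches (L + 1) (insert L S) = switches L S := by
  ext k
  grind [mem_switches]

theorem switches_succ_of_subset {L : ℕ} {S : Finset ℕ} (hS : S ⊆ range L) :
    switches (L + 2) S = switches (L + 1) S := by
  ext k
  grind [mem_switches]

theorem switches_succ_insert {L : ℕ} {S : Finset ℕ} (hS : S ⊆ range L) :
    switches (L + 2) (insert L S) = insert L (switches L S) := by
  ext k
  grind [mem_switches]

theorem card_switches_le (L : ℕ) (S : Finset ℕ) : #(switches L S) ≤ #S :=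
  card_le_card (filter_subset _ _)

theorem card_switches_add_card_le {L : ℕ} {S : Finset ℕ} (hS : S ⊆ range L) :
    #(switches L S) + #S ≤ L := by
  have hsucc : (switches L S).map (addRightEmbedding 1) ⊆ range L \ S := by
    intro k hk
    grind [mem_switches]
  have hcard := card_le_card hsucc
  rw [card_map, card_sdiff_of_subset hS, card_range] at hcard
  have := card_le_card hS
  rw [card_range] at this
  omega

theorem sum_powersetCard_range_succ {M : Type*} [AddCommMonoid M] (L m : ℕ) (g : Finset ℕ → M) :
    ∑ S ∈ (range (L + 1)).powersetCard (m + 1), g S =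
      ∑ S ∈ (range L).powersetCard (m + 1), g S +
        ∑ S ∈ (range L).powersetCard m, g (insert L S) := by
  have last_notMem {k S} (hS : S ∈ (range L).powersetCard k) : L ∉ S := fun h => by
    simpa using (mem_powersetCard.1 hS).1 h
  rw [range_add_one, powersetCard_succ_insert notMem_range_self, sum_union, sum_image]
  · intro S hS S' hS' h
    rw [← erase_insert (last_notMem hS), h, erase_insert (last_notMem hS')]
  · refine disjoint_left.2 fun S hS hS' => ?_
    obtain ⟨S', -, rfl⟩ := mem_image.1 hS'
    exact last_notMem hS (mem_insert_self _ _)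

/-- The sum of `f` over the numbers of switches of all words of length `L` in two letters in which
the first letter occurs `m` times. -/
def switchSum {M : Type*} [AddCommMonoid M] (L m : ℕ) (f : ℕ → M) : M :=
  ∑ S ∈ (range L).powersetCard m, f #(switches L S)

section

variable {M : Type*} [AddCommMonoid M]

theorem switchSum_zero (L : ℕ) (f : ℕ → M) : switchSum L 0 f = f 0 := by
  simp [switchSum, switches]

theorem switchSum_self (L : ℕ) (f : ℕ → M) : switchSum L L f = f 0 := by
  have hself : (range L).powersetCard L = {range L} := by
    simpa only [card_range] using powersetCard_self (range L)
  have hempty : switches L (range L) = ∅ := by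
    simp [switches]
  rw [switchSum, hself, sum_singleton, hempty, card_empty]

theorem switchSum_add (L m : ℕ) (f g : ℕ → M) :
    switchSum L m (fun a => f a + g a) = switchSum L m f + switchSum L m g :=
  sum_add_distrib

/-- Remove the last letter; this loses a switch exactly if the last two letters form one. The
correction term is on the left because `M` has no subtraction. -/
theorem switchSum_succ_succ (L m : ℕ) (f : ℕ → M) :
    switchSum (L + 2) (m + 1) f + switchSum L m f =
      switchSum (L + 1) m f + switchSum (L + 1) (m + 1) f + switchSum L m (fun a => f (a + 1)) := by
  have first_last :
      ∑ S ∈ (range (L + 1)).powersetCard m, f #(switches (L + 2) (insert (L + 1) S)) =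
        switchSum (L + 1) m f := by
    simp only [switchSum, switches_insert_last]
  have second_last_two : ∑ S ∈ (range L).powersetCard (m + 1), f #(switches (L + 2) S) =
      ∑ S ∈ (range L).powersetCard (m + 1), f #(switches (L + 1) S) :=
    sum_congr rfl fun S hS => by rw [switches_succ_of_subset (mem_powersetCard.1 hS).1]
  have switch_last : ∑ S ∈ (range L).powersetCard m, f #(switches (L + 2) (insert L S)) =
      switchSum L m (fun a => f (a + 1)) := by
    refine sum_congr rfl fun S hS => ?_
    have hL : L ∉ switches L S := by simp [mem_switches]
    rw [switches_succ_insert (mem_powersetCard.1 hS).1, card_insert_of_notMem hL]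
  have split_last : switchSum (L + 1) (m + 1) f =
      ∑ S ∈ (range L).powersetCard (m + 1), f #(switches (L + 1) S) + switchSum L m f := by
    simp only [switchSum, sum_powersetCard_range_succ, switches_insert_last]
  rw [split_last, switchSum, sum_powersetCard_range_succ, sum_powersetCard_range_succ, first_last,
    second_last_two, switch_last]
  abel

end

theorem switchSum_choose_succ (N L m : ℕ) :
    switchSum (L + 2) (m + 1) (fun a => (N + 1 + a).choose (L + 2)) =
      switchSum (L + 2) (m + 1) (fun a => (N + a).choose (L + 2)) +
        switchSum (L + 1) m (fun a => (N + a).choose (L + 1)) +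
        switchSum (L + 1) (m + 1) (fun a => (N + a).choose (L + 1)) +
        switchSum L m (fun a => (N + a).choose L) := by
  have recursion := switchSum_succ_succ L m fun a => (N + a).choose (L + 1)
  simp only [← add_assoc, Nat.choose_succ_succ', switchSum_add] at recursion
  simp only [add_right_comm N 1, Nat.choose_succ_succ' _ (L + 1), switchSum_add]
  linarith

theorem switchSum_choose (N m n : ℕ) :
    switchSum (m + n) m (fun a => (N + a).choose (m + n)) = N.choose m * N.choose n := by
  induction N generalizing m n with
  | zero =>
    rcases m with _ | m
    · simp [switchSum_zero]
    rcases n with _ | n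
    · simp [switchSum_self]
    refine (sum_eq_zero fun S hS => Nat.choose_eq_zero_of_lt ?_).trans (by simp)
    have := card_switches_le (m + 1 + (n + 1)) S
    have := (mem_powersetCard.1 hS).2
    omega
  | succ N ih =>
    rcases m with _ | m
    · simp [switchSum_zero]
    rcases n with _ | n
    · simp [switchSum_self]
    have ih_left := ih (m + 1) n
    have ih_right := ih m (n + 1)
    have ih_both := ih (m + 1) (n + 1)
    rw [show m + 1 + n = m + n + 1 by ring] at ih_left
    rw [show m + (n + 1) = m + n + 1 by ring] at ih_right
    rw [show m + 1 + (n + 1) = m + n + 2 by ring] at ih_both ⊢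
    rw [switchSum_choose_succ, ih m n, ih_left, ih_right, ih_both, Nat.choose_succ_succ',
      Nat.choose_succ_succ']
    ring

theorem sum_powerset_choose_sub_card {α : Type*} {s : Finset α} {k : ℕ} (hk : #s ≤ k) (N : ℕ) :
    ∑ T ∈ s.powerset, N.choose (k - #T) = (N + #s).choose k := by
  rw [sum_powerset_apply_card fun i => N.choose (k - i), add_comm N, Nat.add_choose_eq,
    Nat.sum_antidiagonal_eq_sum_range_succ fun i j => (#s).choose i * N.choose j]
  refine sum_subset (range_subset_range.2 (by omega)) fun i _ hi => ?_
  rw [Nat.choose_eq_zero_of_lt (by simpa using hi), zero_smul]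

end Switches

section Shuffle

variable {m n : ℕ} {σ τ : Equiv.Perm (Fin (m + n))}

/-- The positions that the first `m` factors take in the shuffle `σ`. -/
def leftPositions (m n : ℕ) (σ : Equiv.Perm (Fin (m + n))) : Finset (Fin (m + n)) :=
  {k | (σ k : ℕ) < m}

theorem mem_leftPositions {k : Fin (m + n)} : k ∈ leftPositions m n σ ↔ (σ k : ℕ) < m := by
  simp [leftPositions]

theorem card_leftPositions (σ : Equiv.Perm (Fin (m + n))) : #(leftPositions m n σ) = m := by
  have hmap : (leftPositions m n σ).map σ.toEmbedding =
      ({i | (i : ℕ) < m} : Finset (Fin (m + n))) := by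
    ext i
    simp [leftPositions, mem_map_equiv]
  rw [← card_map, hmap, Fin.card_filter_val_lt, min_eq_right (Nat.le_add_right m n)]

theorem card_compl_eq_right {S : Finset (Fin (m + n))} (hS : #S = m) : #Sᶜ = n := by
  rw [card_compl, hS, Fintype.card_fin, Nat.add_sub_cancel_left]

theorem IsShuffle.inv_castAdd (hσ : IsShuffle m n σ) (i : Fin m) :
    σ⁻¹ (Fin.castAdd n i) = (leftPositions m n σ).orderEmbOfFin (card_leftPositions σ) i :=
  congr_fun (orderEmbOfFin_unique _ (fun i => by simp [mem_leftPositions]) hσ.1) i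

theorem IsShuffle.inv_natAdd (hσ : IsShuffle m n σ) (j : Fin n) :
    σ⁻¹ (Fin.natAdd m j) = (leftPositions m n σ)ᶜ.orderEmbOfFin
      (card_compl_eq_right (card_leftPositions σ)) j :=
  congr_fun (orderEmbOfFin_unique _ (fun j => by simp [mem_leftPositions]) hσ.2) j

theorem IsShuffle.eq_of_leftPositions_eq (hσ : IsShuffle m n σ) (hτ : IsShuffle m n τ)
    (h : leftPositions m n σ = leftPositions m n τ) : σ = τ := by
  refine inv_injective (Equiv.ext fun k => Fin.addCases (fun i => ?_) (fun j => ?_) k)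
  · simp only [hσ.inv_castAdd, hτ.inv_castAdd, h]
  · simp only [hσ.inv_natAdd, hτ.inv_natAdd, h]

theorem exists_isShuffle_leftPositions_eq {S : Finset (Fin (m + n))} (hS : #S = m) :
    ∃ σ, IsShuffle m n σ ∧ leftPositions m n σ = S := by
  have hSc := card_compl_eq_right hS
  let e : Equiv.Perm (Fin (m + n)) := finSumFinEquiv.symm.trans (finSumEquivOfFinset hS hSc)
  have e_castAdd (i : Fin m) : e (Fin.castAdd n i) = S.orderEmbOfFin hS i := by simp [e]
  have e_natAdd (j : Fin n) : e (Fin.natAdd m j) = Sᶜ.orderEmbOfFin hSc j := by simp [e]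
  refine ⟨e⁻¹, ⟨?_, ?_⟩, ?_⟩
  · simpa only [inv_inv, e_castAdd] using (S.orderEmbOfFin hS).strictMono
  · simpa only [inv_inv, e_natAdd] using (Sᶜ.orderEmbOfFin hSc).strictMono
  · ext k
    obtain ⟨l, rfl⟩ := e.surjective k
    rw [mem_leftPositions, Equiv.Perm.inv_def, Equiv.symm_apply_apply]
    refine Fin.addCases (fun i => ?_) (fun j => ?_) l
    · simp [e_castAdd]
    · simpa [e_natAdd, -orderEmbOfFin_mem] using orderEmbOfFin_mem Sᶜ hSc j

open Classical in
theorem sum_isShuffle_leftPositions {M : Type*} [AddCommMonoid M] (f : Finset (Fin (m + n)) → M) :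
    ∑ σ with IsShuffle m n σ, f (leftPositions m n σ) = ∑ S ∈ univ.powersetCard m, f S := by
  refine sum_bij (fun σ _ => leftPositions m n σ) (fun σ _ => ?_) (fun σ hσ τ hτ => ?_)
    (fun S hS => ?_) fun _ _ => rfl
  · exact mem_powersetCard_univ.2 (card_leftPositions σ)
  · exact (mem_filter.1 hσ).2.eq_of_leftPositions_eq (mem_filter.1 hτ).2
  · obtain ⟨σ, hσ, rfl⟩ := exists_isShuffle_leftPositions_eq (mem_powersetCard_univ.1 hS)
    exact ⟨σ, by simpa using hσ, rfl⟩

open Classical in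
/-- The set of the admissible pairs `(k, k+1)` of a shuffle, encoded by `k`. -/
def admissible (m n : ℕ) (σ : Equiv.Perm (Fin (m + n))) : Finset (Fin (m + n)) :=
  {k | IsAdmissible m n σ k}

theorem mem_admissible {k : Fin (m + n)} : k ∈ admissible m n σ ↔ IsAdmissible m n σ k := by
  simp [admissible]

theorem isAdmissible_iff {k : Fin (m + n)} : IsAdmissible m n σ k ↔
    (k : ℕ) ∈ switches (m + n) ((leftPositions m n σ).map Fin.valEmbedding) := by
  have mem_map_val (l : Fin (m + n)) :
      (l : ℕ) ∈ (leftPositions m n σ).map Fin.valEmbedding ↔ (σ l : ℕ) < m :=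
    (mem_map' Fin.valEmbedding).trans mem_leftPositions
  rw [mem_switches, mem_map_val]
  constructor
  · rintro ⟨hk, hleft, hright⟩
    exact ⟨hleft, hk, fun h => ((mem_map_val ⟨k + 1, hk⟩).1 h).not_ge hright⟩
  · rintro ⟨hleft, hk, hright⟩
    exact ⟨hk, hleft, not_lt.1 fun h => hright ((mem_map_val ⟨k + 1, hk⟩).2 h)⟩

theorem map_leftPositions_subset_range (σ : Equiv.Perm (Fin (m + n))) :
    (leftPositions m n σ).map Fin.valEmbedding ⊆ range (m + n) := fun k hk => by
  obtain ⟨k, -, rfl⟩ := mem_map.1 hk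
  exact mem_range.2 k.isLt

theorem map_admissible (σ : Equiv.Perm (Fin (m + n))) :
    (admissible m n σ).map Fin.valEmbedding =
      switches (m + n) ((leftPositions m n σ).map Fin.valEmbedding) := by
  ext k
  constructor
  · intro hk
    obtain ⟨l, hl, rfl⟩ := mem_map.1 hk
    exact isAdmissible_iff.1 (mem_admissible.1 hl)
  · intro hk
    have hlt := mem_range.1 (map_leftPositions_subset_range σ (mem_switches.1 hk).1)
    exact mem_map.2 ⟨⟨k, hlt⟩, mem_admissible.2 (isAdmissible_iff.2 hk), rfl⟩

theorem card_admissible (σ : Equiv.Perm (Fin (m + n))) :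
    #(admissible m n σ) = #(switches (m + n) ((leftPositions m n σ).map Fin.valEmbedding)) := by
  rw [← map_admissible, card_map]

theorem card_admissible_le_left (σ : Equiv.Perm (Fin (m + n))) : #(admissible m n σ) ≤ m := by
  rw [card_admissible]
  refine (card_switches_le _ _).trans_eq ?_
  rw [card_map, card_leftPositions]

theorem card_admissible_le_right (σ : Equiv.Perm (Fin (m + n))) : #(admissible m n σ) ≤ n := by
  have := card_switches_add_card_le (map_leftPositions_subset_range σ)
  rw [card_map, card_leftPositions] at this
  rw [card_admissible]
  omega

open Classical in
theorem sum_isShuffle_card_admissible {M : Type*} [AddCommMonoid M] (f : ℕ → M) :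
    ∑ σ with IsShuffle m n σ, f #(admissible m n σ) = switchSum (m + n) m f := by
  have hrange : (range (m + n)).powersetCard m = (univ.powersetCard m).map
      (mapEmbedding (Fin.valEmbedding (n := m + n))).toEmbedding := by
    rw [← powersetCard_map, Fin.map_valEmbedding_univ, Nat.Iio_eq_range]
  simp only [card_admissible]
  rw [sum_isShuffle_leftPositions fun S => f #(switches (m + n) (S.map Fin.valEmbedding)),
    switchSum, hrange, sum_map]
  rfl

end Shuffle

namespace MixableShuffle

variable {m n : ℕ}

theorem merged_subset_admissible (s : MixableShuffle m n) : s.merged ⊆ admissible m n s.perm :=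
  fun k hk => mem_admissible.2 (s.2.2 k hk)

theorem card_merged_le_left (s : MixableShuffle m n) : #s.merged ≤ m :=
  (card_le_card s.merged_subset_admissible).trans (card_admissible_le_left _)

theorem card_merged_le_right (s : MixableShuffle m n) : #s.merged ≤ n :=
  (card_le_card s.merged_subset_admissible).trans (card_admissible_le_right _)

open Classical in
theorem sum_merged {M : Type*} [AddCommMonoid M] (f : Finset (Fin (m + n)) → M) :
    ∑ s : MixableShuffle m n, f s.merged =
      ∑ σ with IsShuffle m n σ, ∑ T ∈ (admissible m n σ).powerset, f T := by
  let r : Finset (Equiv.Perm (Fin (m + n)) × Finset (Fin (m + n))) :=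
    {s | IsShuffle m n s.1 ∧ ∀ k ∈ s.2, IsAdmissible m n s.1 k}
  calc ∑ s : MixableShuffle m n, f s.merged
      = ∑ s ∈ r, f s.2 :=
        (sum_subtype r (fun s => by simp [r]) fun s => f s.2).symm
    _ = ∑ σ with IsShuffle m n σ, ∑ T ∈ (admissible m n σ).powerset, f T :=
        sum_finset_product r _ _ fun s => by simp [r, subset_iff, mem_admissible]

theorem sum_choose (N m n : ℕ) :
    ∑ s : MixableShuffle m n, N.choose (m + n - #s.merged) = N.choose m * N.choose n := by
  classical
  calc ∑ s : MixableShuffle m n, N.choose (m + n - #s.merged)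
      = ∑ σ with IsShuffle m n σ, (N + #(admissible m n σ)).choose (m + n) := by
        rw [sum_merged fun T => N.choose (m + n - #T)]
        refine sum_congr rfl fun σ _ => sum_powerset_choose_sub_card ?_ N
        exact (card_admissible_le_left σ).trans (Nat.le_add_right m n)
    _ = switchSum (m + n) m (fun a => (N + a).choose (m + n)) :=
        sum_isShuffle_card_admissible fun a => (N + a).choose (m + n)
    _ = N.choose m * N.choose n := switchSum_choose N m n

end MixableShuffle

/-! ### The shuffle Baxter algebras -/

section Graded

variable {C : Type*} [CommRing C] {lam : C} {A : Type*} [CommRing A] [Algebra C A]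

namespace Sha

theorem toModule_incl {N : Type*} [AddCommGroup N] [Module C N]
    (φ : ∀ k, TPow C A (k + 1) →ₗ[C] N) (k : ℕ) (a : TPow C A (k + 1)) :
    DirectSum.toModule C ℕ N φ (incl lam A k a) = φ k a :=
  DirectSum.toModule_lof C (M := fun k => TPow C A (k + 1)) k a

theorem proj_incl_self (k : ℕ) (a : TPow C A (k + 1)) : proj lam A k (incl lam A k a) = a :=
  DirectSum.component.lof_self C (M := fun k => TPow C A (k + 1)) k a

theorem proj_incl_of_ne {k l : ℕ} (h : k ≠ l) (a : TPow C A (k + 1)) :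
    proj lam A l (incl lam A k a) = 0 :=
  DFinsupp.single_eq_of_ne h.symm

theorem linearMap_ext {N : Type*} [AddCommGroup N] [Module C N] {f g : Sha lam A →ₗ[C] N}
    (h : ∀ k a, f (incl lam A k a) = g (incl lam A k a)) : f = g :=
  DirectSum.linearMap_ext C fun k => LinearMap.ext fun a => h k a

theorem one_eq_incl_one : (1 : Sha lam A) = incl lam A 0 1 :=
  congr_arg (incl lam A 0) (map_one (PiTensorProduct.singleAlgHom (R := C) 0))

theorem mul_def (x y : Sha lam A) : x * y = mul lam A x y := rfl

theorem mulHom_apply {m n : ℕ} (a : TPow C A (m + 1)) (b : TPow C A (n + 1)) :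
    mulHom lam A m n a b = ∑ s : MixableShuffle m n, lam ^ #s.merged •
      incl lam A (m + n - #s.merged) (place s.slotLeft a * place s.slotRight b) := by
  simp [mulHom, LinearMap.sum_apply]

theorem mul_incl_incl {m n : ℕ} (a : TPow C A (m + 1)) (b : TPow C A (n + 1)) :
    incl lam A m a * incl lam A n b = mulHom lam A m n a b :=
  (LinearMap.congr_fun (toModule_incl _ m a) _).trans
    (LinearMap.congr_fun (toModule_incl (fun n => (mulHom lam A m n).flip) n b) a)

theorem proj_mul_incl_incl_eq_zero {m n k : ℕ} (h : k < m ∨ k < n) (a : TPow C A (m + 1))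
    (b : TPow C A (n + 1)) : proj lam A k (incl lam A m a * incl lam A n b) = 0 := by
  rw [mul_incl_incl, mulHom_apply, map_sum]
  refine sum_eq_zero fun s _ => ?_
  have hleft := s.card_merged_le_left
  have hright := s.card_merged_le_right
  rw [map_smul, proj_incl_of_ne (by omega), smul_zero]

theorem proj_incl_mul_eq_zero {m k : ℕ} (h : k < m) (a : TPow C A (m + 1)) (y : Sha lam A) :
    proj lam A k (incl lam A m a * y) = 0 :=
  LinearMap.congr_fun (f := proj lam A k ∘ₗ mul lam A (incl lam A m a)) (g := 0)
    (linearMap_ext fun _ b => proj_mul_incl_incl_eq_zero (Or.inl h) a b) y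

theorem proj_mul_incl_eq_zero {n k : ℕ} (h : k < n) (b : TPow C A (n + 1)) (x : Sha lam A) :
    proj lam A k (x * incl lam A n b) = 0 :=
  LinearMap.congr_fun (f := proj lam A k ∘ₗ (mul lam A).flip (incl lam A n b)) (g := 0)
    (linearMap_ext fun _ a => proj_mul_incl_incl_eq_zero (Or.inr h) a b) x

theorem op_incl {n : ℕ} (a : TPow C A (n + 1)) :
    op lam A (incl lam A n a) = incl lam A (n + 1) (place Fin.succ a) :=
  toModule_incl _ n a

end Sha

namespace ShaHat

theorem ofSha_apply (x : Sha lam A) (k : ℕ) : ofSha lam A x k = Sha.proj lam A k x := rfl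

theorem ofSha_injective : Function.Injective (ofSha lam A) := fun _ _ h =>
  DirectSum.ext_component C fun k => congr_fun h k

theorem trunc_succ (k : ℕ) (x : ShaHat lam A) :
    trunc lam A (k + 1) x = trunc lam A k x + Sha.incl lam A (k + 1) (x (k + 1)) :=
  sum_range_succ _ _

theorem ofSha_trunc_of_le {i k : ℕ} (h : i ≤ k) (x : ShaHat lam A) :
    ofSha lam A (trunc lam A k x) i = x i := by
  rw [ofSha_apply, trunc, map_sum]
  exact (sum_eq_single_of_mem i (mem_range.2 (by omega)) fun j _ hj =>
    Sha.proj_incl_of_ne hj _).trans (Sha.proj_incl_self i _)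

theorem mul_apply_of_le {i k : ℕ} (h : i ≤ k) (x y : ShaHat lam A) :
    (x * y) i = ofSha lam A (trunc lam A k x * trunc lam A k y) i := by
  induction k, h using Nat.le_induction with
  | base => rfl
  | succ k hk ih =>
    have distrib (u v u' v' : Sha lam A) :
        (u + u') * (v + v') = u * v + u' * v + (u + u') * v' := by
      simp only [Sha.mul_def, map_add, LinearMap.add_apply]
    rw [ih, ofSha_apply, ofSha_apply, trunc_succ, trunc_succ, distrib, map_add, map_add,
      Sha.proj_incl_mul_eq_zero (by omega), Sha.proj_mul_incl_eq_zero (by omega), add_zero,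
      add_zero]

theorem one_eq_ofSha_incl_one : (1 : ShaHat lam A) = ofSha lam A (Sha.incl lam A 0 1) :=
  congr_arg (ofSha lam A) Sha.one_eq_incl_one

theorem one_apply_zero : (1 : ShaHat lam A) 0 = 1 := by
  rw [one_eq_ofSha_incl_one, ofSha_apply, Sha.proj_incl_self]

theorem one_apply_succ (k : ℕ) : (1 : ShaHat lam A) (k + 1) = 0 := by
  rw [one_eq_ofSha_incl_one, ofSha_apply, Sha.proj_incl_of_ne k.succ_ne_zero.symm]

theorem op_apply_zero (x : ShaHat lam A) : op lam A x 0 = 0 := rfl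

theorem op_apply_succ (x : ShaHat lam A) (k : ℕ) :
    op lam A x (k + 1) = place Fin.succ (x k) := rfl

theorem op_ofSha (x : Sha lam A) : op lam A (ofSha lam A x) = ofSha lam A (Sha.op lam A x) := by
  refine LinearMap.congr_fun (f := op lam A ∘ₗ ofSha lam A) (g := ofSha lam A ∘ₗ Sha.op lam A)
    (Sha.linearMap_ext fun k a => ?_) x
  rw [LinearMap.comp_apply, LinearMap.comp_apply, Sha.op_incl]
  funext l
  rcases l with _ | l
  · rw [op_apply_zero, ofSha_apply, Sha.proj_incl_of_ne (Nat.succ_ne_zero k)]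
  rw [op_apply_succ, ofSha_apply, ofSha_apply]
  obtain rfl | hl := eq_or_ne k l
  · rw [Sha.proj_incl_self, Sha.proj_incl_self]
  · rw [Sha.proj_incl_of_ne hl, Sha.proj_incl_of_ne (Nat.succ_injective.ne hl), map_zero]

end ShaHat

end Graded

/-! ### Sequences in the direct limit -/

section Limit

variable {C : Type*} [CommRing C] {A : Type*} [CommRing A] [Algebra C A]

theorem Bar.of_place {m n : ℕ+} (h : m ≤ n) (x : TPow C A m) :
    Bar.of C A n (place (Fin.castLE h) x) = Bar.of C A m x :=
  Ring.DirectLimit.of_f _ _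

theorem Bar.of_algebraMap (n : ℕ+) (c : C) :
    Bar.of C A n (algebraMap C (TPow C A n) c) = algebraMap C (Bar C A) c :=
  (congr_arg _ (AlgHom.commutes _ c).symm).trans
    (Bar.of_place (one_le (a := n)) (algebraMap C (TPow C A ((1 : ℕ+) : ℕ)) c))

theorem stdOp_apply (lam : C) (x : StdSeq C A) (n : ℕ+) :
    stdOp A lam x n = lam • ∑ i ∈ Iio n, x i := by
  simp [stdOp, LinearMap.sum_apply]

theorem stdOp_one (lam : C) (x : StdSeq C A) : stdOp A lam x 1 = 0 := by
  rw [stdOp_apply, Iio_eq_empty.2 fun _ _ => one_le, sum_empty, smul_zero]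

theorem stdOp_add_one (lam : C) (x : StdSeq C A) (n : ℕ+) :
    stdOp A lam x (n + 1) = stdOp A lam x n + lam • x n := by
  have hIio : Iio (n + 1) = insert n (Iio n) := by
    ext i
    rw [mem_Iio, mem_insert, mem_Iio, PNat.lt_add_one_iff, le_iff_eq_or_lt]
  rw [stdOp_apply, stdOp_apply, hIio, sum_insert notMem_Iio_self, smul_add, add_comm]

theorem stdOp_injective {lam : C} (hlam : IsSMulRegular (Bar C A) lam) :
    Function.Injective (stdOp A lam) := by
  refine (injective_iff_map_eq_zero _).2 fun x hx => funext fun n => hlam ?_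
  have hsucc := stdOp_add_one lam x n
  rw [hx] at hsucc
  simpa using hsucc.symm

/-- The canonical isomorphism `C^{⊗ n} ≃ C`, by which an element of `C^{⊗ n}` is identified with
its coefficient with respect to `1 ⊗ ⋯ ⊗ 1`. -/
def TPow.selfEquiv (n : ℕ) : TPow C C n ≃ₐ[C] C := PiTensorProduct.constantBaseRingEquiv (Fin n) C

theorem TPow.eq_smul_one {n : ℕ} (x : TPow C C n) : x = selfEquiv n x • (1 : TPow C C n) :=
  (selfEquiv n).injective (by simp)

theorem TPow.selfEquiv_algHom {m n : ℕ} (f : TPow C C m →ₐ[C] TPow C C n) (x : TPow C C m) :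
    selfEquiv n (f x) = selfEquiv m x := by
  conv_lhs => rw [eq_smul_one x]
  simp

theorem Bar.of_eq_algebraMap (n : ℕ+) (x : TPow C C n) :
    Bar.of C C n x = algebraMap C (Bar C C) (TPow.selfEquiv n x) := by
  rw [← Bar.of_algebraMap n, Algebra.algebraMap_eq_smul_one, ← TPow.eq_smul_one]

theorem Bar.algebraMap_bijective : Function.Bijective (algebraMap C (Bar C C)) := by
  constructor
  · let retract : Bar C C →+* C := Ring.DirectLimit.lift _ _ C
      (fun n : ℕ+ => (TPow.selfEquiv (C := C) n : TPow C C n →+* C))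
      (fun _ _ _ x => TPow.selfEquiv_algHom _ x)
    have retract_algebraMap (c : C) : retract (algebraMap C (Bar C C) c) = c :=
      (Ring.DirectLimit.lift_of ..).trans ((TPow.selfEquiv (C := C) ((1 : ℕ+) : ℕ)).commutes c)
    exact Function.LeftInverse.injective retract_algebraMap
  · intro z
    obtain ⟨n, x, rfl⟩ := Ring.DirectLimit.exists_of z
    exact ⟨TPow.selfEquiv n x, (Bar.of_eq_algebraMap n x).symm⟩

theorem Bar.isSMulRegular {lam : C} (hlam : IsLeftRegular lam) : IsSMulRegular (Bar C C) lam := by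
  intro x y hxy
  obtain ⟨c, rfl⟩ := Bar.algebraMap_bijective.2 x
  obtain ⟨d, rfl⟩ := Bar.algebraMap_bijective.2 y
  simp only [Algebra.smul_def, ← map_mul] at hxy
  rw [hlam (Bar.algebraMap_bijective.1 hxy)]

theorem tSeq_eq_smul_one (c : C) : tSeq C c = c • (1 : StdSeq C C) := by
  funext n
  have hprod : ∏ i : Fin n, (if (i : ℕ) + 1 = n then c else 1) = c := by
    obtain ⟨p, hp⟩ := Nat.exists_eq_add_one.2 n.pos
    rw [hp, Fin.prod_univ_castSucc]
    simp [fun i : Fin p => i.isLt.ne]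
  rw [tSeq, Bar.of_eq_algebraMap, TPow.selfEquiv, PiTensorProduct.constantBaseRingEquiv_tprod,
    hprod, Algebra.algebraMap_eq_smul_one, Pi.smul_apply, Pi.one_apply]

end Limit

/-! ### Binomial sequences -/

section Binomial

variable {C : Type*} [CommRing C] (lam : C)

/-- The `p`-th term of the binomial transform of the sequence `lam ^ i * b i`. -/
def binomSum (b : ℕ → C) (p : ℕ) : C :=
  ∑ i ∈ range (p + 1), (p.choose i : C) * lam ^ i * b i

theorem binomSum_zero (b : ℕ → C) : binomSum lam b 0 = b 0 := by
  simp [binomSum]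

theorem binomSum_succ (b : ℕ → C) (p : ℕ) :
    binomSum lam b (p + 1) = binomSum lam b p + lam * binomSum lam (fun i => b (i + 1)) p := by
  have hsplit : binomSum lam b p =
      ∑ i ∈ range (p + 1), (p.choose (i + 1) : C) * lam ^ (i + 1) * b (i + 1) + b 0 := by
    rw [binomSum, sum_range_succ', sum_range_succ _ p]
    simp
  rw [hsplit, binomSum, binomSum, sum_range_succ', mul_sum, add_right_comm, ← sum_add_distrib,
    Nat.choose_zero_right, Nat.cast_one, pow_zero, one_mul, one_mul]
  congr 1
  refine sum_congr rfl fun i _ => ?_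
  rw [Nat.choose_succ_succ', Nat.cast_add]
  ring

theorem binomSum_single (m p : ℕ) : binomSum lam (Pi.single m 1) p = p.choose m * lam ^ m := by
  simp only [binomSum, Pi.single_apply, mul_ite, mul_one, mul_zero, sum_ite_eq', mem_range]
  split_ifs with hm
  · rfl
  · rw [Nat.choose_eq_zero_of_lt (by omega), Nat.cast_zero, zero_mul]

theorem binomSeq_apply (b : ℕ → C) (n : ℕ+) :
    binomSeq lam b n = algebraMap C (Bar C C) (binomSum lam b (n - 1)) := by
  rw [binomSeq, binomSum, Nat.sub_add_cancel n.pos]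

theorem binomSeq_one (b : ℕ → C) : binomSeq lam b 1 = algebraMap C (Bar C C) (b 0) := by
  rw [binomSeq_apply, PNat.one_coe, Nat.sub_self, binomSum_zero]

theorem binomSeq_add_one (b : ℕ → C) (n : ℕ+) :
    binomSeq lam b (n + 1) = binomSeq lam b n + lam • binomSeq lam (fun i => b (i + 1)) n := by
  have hn : (n + 1 : ℕ+) - 1 = (n - 1 : ℕ) + 1 := by
    have := n.pos
    rw [PNat.add_coe, PNat.one_coe]
    omega
  simp only [binomSeq_apply, hn, binomSum_succ, map_add, map_mul, Algebra.smul_def]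

theorem binomSeq_eq (b : ℕ → C) :
    binomSeq lam b = b 0 • (1 : StdSeq C C) + stdOp C lam (binomSeq lam fun i => b (i + 1)) := by
  funext n
  rw [Pi.add_apply, Pi.smul_apply, Pi.one_apply, ← Algebra.algebraMap_eq_smul_one]
  induction n using PNat.recOn with
  | one => rw [stdOp_one, add_zero, binomSeq_one]
  | succ n ih => rw [stdOp_add_one, ← add_assoc, ← ih, binomSeq_add_one]

/-- The sequence `binomSeq lam b`, as a linear map in `b`. -/
def binomSeqHom : (ℕ → C) →ₗ[C] StdSeq C C where
  toFun := binomSeq lam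
  map_add' b b' := by
    funext n
    simp only [binomSeq, Pi.add_apply, mul_add, sum_add_distrib, map_add]
  map_smul' c b := by
    funext n
    simp only [binomSeq, Pi.smul_apply, smul_eq_mul, mul_left_comm _ c, ← mul_sum, map_mul,
      RingHom.id_apply, Algebra.smul_def]

theorem binomSeqHom_injective {lam : C} (hlam : IsLeftRegular lam) :
    Function.Injective (binomSeqHom lam) := by
  have head_eq_zero {b : ℕ → C} (hb : binomSeq lam b = 0) : b 0 = 0 := by
    apply Bar.algebraMap_bijective.1
    rw [← binomSeq_one lam, hb, Pi.zero_apply, map_zero]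
  have tail_eq_zero {b : ℕ → C} (hb : binomSeq lam b = 0) :
      binomSeq lam (fun i => b (i + 1)) = 0 := by
    apply stdOp_injective (Bar.isSMulRegular hlam)
    have hrec := binomSeq_eq lam b
    rwa [hb, head_eq_zero hb, zero_smul, zero_add, eq_comm, ← map_zero (stdOp C lam)] at hrec
  refine (injective_iff_map_eq_zero _).2 fun b hb => ?_
  funext i
  induction i generalizing b with
  | zero => exact head_eq_zero hb
  | succ i ih => exact ih _ (tail_eq_zero hb)

end Binomial

/-! ### Coefficients over the base ring -/

section Base

variable {C : Type*} [CommRing C] (lam : C)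

namespace Sha

/-- The element `1^{⊗ (n+1)}` of `Ш_C(C)`. -/
def ones (n : ℕ) : Sha lam C := incl lam C n 1

theorem one_eq_ones_zero : (1 : Sha lam C) = ones lam 0 := one_eq_incl_one

theorem j_eq_smul_one (c : C) : j lam C c = c • (1 : Sha lam C) := by
  rw [← mul_one c, ← smul_eq_mul, map_smul, smul_eq_mul, mul_one]
  rfl

theorem op_ones (n : ℕ) : op lam C (ones lam n) = ones lam (n + 1) := by
  rw [ones, op_incl, map_one, ones]

theorem ones_mul_ones (m n : ℕ) :
    ones lam m * ones lam n =
      ∑ s : MixableShuffle m n, lam ^ #s.merged • ones lam (m + n - #s.merged) := by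
  simp only [ones, mul_incl_incl, mulHom_apply, map_one, mul_one]

theorem span_range_ones : Submodule.span C (Set.range (ones lam)) = ⊤ := by
  have hincl : ⨆ n, LinearMap.range (incl lam C n) = ⊤ := DFinsupp.iSup_range_lsingle
  rw [eq_top_iff, ← hincl]
  refine iSup_le fun n => ?_
  rintro _ ⟨a, rfl⟩
  rw [TPow.eq_smul_one a, map_smul]
  exact Submodule.smul_mem _ _ (Submodule.subset_span ⟨n, rfl⟩)

variable {lam}

theorem linearMap_ext_ones {N : Type*} [AddCommMonoid N] [Module C N] {f g : Sha lam C →ₗ[C] N}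
    (h : ∀ n, f (ones lam n) = g (ones lam n)) : f = g :=
  LinearMap.ext_on_range (span_range_ones lam) h

theorem linearMap_ext_of_map_op {N : Type*} [AddCommMonoid N] [Module C N] {Q : N →ₗ[C] N}
    {f g : Sha lam C →ₗ[C] N} (hf : ∀ x, f (op lam C x) = Q (f x))
    (hg : ∀ x, g (op lam C x) = Q (g x)) (h : f 1 = g 1) : f = g := by
  refine linearMap_ext_ones fun n => ?_
  induction n with
  | zero => rwa [← one_eq_ones_zero]
  | succ n ih => rw [← op_ones, hf, hg, ih]

end Sha

namespace ShaHat

/-- The coefficients `b_n` of a series `∑_n b_n 1^{⊗ (n+1)}`. -/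
def coeffs : ShaHat lam C ≃ₗ[C] (ℕ → C) :=
  LinearEquiv.piCongrRight fun n => (TPow.selfEquiv (n + 1)).toLinearEquiv

theorem coeffs_symm : ⇑(coeffs lam).symm = shaHatSum lam := by
  funext b
  refine (LinearEquiv.symm_apply_eq _).2 (funext fun n => ?_)
  change b n = TPow.selfEquiv (n + 1) (b n • (1 : TPow C C (n + 1)))
  rw [map_smul, map_one, smul_eq_mul, mul_one]

theorem coeffs_shaHatSum (b : ℕ → C) : coeffs lam (shaHatSum lam b) = b := by
  rw [← coeffs_symm, LinearEquiv.apply_symm_apply]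

end ShaHat

theorem shaHatSum_bijective : Function.Bijective (shaHatSum lam) :=
  ShaHat.coeffs_symm lam ▸ (ShaHat.coeffs lam).symm.bijective

theorem shaHatSum_eq (b : ℕ → C) :
    shaHatSum lam b =
      b 0 • (1 : ShaHat lam C) + ShaHat.op lam C (shaHatSum lam fun i => b (i + 1)) := by
  funext k
  change b k • (1 : TPow C C (k + 1)) = b 0 • (1 : ShaHat lam C) k + ShaHat.op lam C _ k
  rcases k with _ | k
  · rw [ShaHat.one_apply_zero, ShaHat.op_apply_zero, add_zero]
  · rw [ShaHat.one_apply_succ, ShaHat.op_apply_succ, smul_zero, zero_add]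
    change _ = place Fin.succ (b (k + 1) • (1 : TPow C C (k + 1)))
    rw [map_smul, map_one]

theorem ShaHat.ofSha_ones (n : ℕ) :
    ofSha lam C (Sha.ones lam n) = shaHatSum lam (Pi.single n (1 : C)) := by
  funext k
  change Sha.proj lam C k (Sha.incl lam C n 1) = (Pi.single n 1 : ℕ → C) k • 1
  obtain rfl | hk := eq_or_ne n k
  · rw [Sha.proj_incl_self, Pi.single_eq_same, one_smul]
  · rw [Sha.proj_incl_of_ne hk, Pi.single_eq_of_ne hk.symm, zero_smul]

theorem shaSum_eq_linearCombination :
    shaSum lam = Finsupp.linearCombination C (Sha.ones lam) := rfl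

theorem ShaHat.ofSha_shaSum (b : ℕ →₀ C) : ofSha lam C (shaSum lam b) = shaHatSum lam b := by
  rw [shaSum_eq_linearCombination, ← coeffs_symm]
  refine LinearMap.congr_fun
    (f := ofSha lam C ∘ₗ Finsupp.linearCombination C (Sha.ones lam))
    (g := (coeffs lam).symm.toLinearMap ∘ₗ Finsupp.lcoeFun) (Finsupp.lhom_ext' fun n => ?_) b
  ext
  simp [ofSha_ones, coeffs_symm, Finsupp.single_eq_pi_single]

theorem shaSum_bijective : Function.Bijective (shaSum lam) := by
  constructor
  · intro b b' h
    have hseries := congr_arg (ShaHat.ofSha lam C) h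
    rw [ShaHat.ofSha_shaSum, ShaHat.ofSha_shaSum] at hseries
    exact DFunLike.coe_injective ((shaHatSum_bijective lam).1 hseries)
  · rw [shaSum_eq_linearCombination, ← LinearMap.range_eq_top, Finsupp.range_linearCombination,
      Sha.span_range_ones]

theorem ShaHat.linearMap_ext_of_map_op {A : Type*} [CommRing A] [Algebra C A] {lam : C}
    {f g : ShaHat lam C →ₗ[C] StdSeq C A} (hf : ∀ x, f (op lam C x) = stdOp A lam (f x))
    (hg : ∀ x, g (op lam C x) = stdOp A lam (g x)) (h : f 1 = g 1) : f = g := by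
  refine LinearMap.ext fun x => funext fun n => ?_
  induction n using PNat.strongInductionOn generalizing x with
  | _ n ih =>
    obtain ⟨b, rfl⟩ := (shaHatSum_bijective lam).2 x
    rw [shaHatSum_eq, map_add, map_add, map_smul, map_smul, h, hf, hg, Pi.add_apply,
      Pi.add_apply, stdOp_apply, stdOp_apply, sum_congr rfl fun i hi => ih i (mem_Iio.1 hi) _]

/-! ### The homomorphisms to the sequences -/

namespace ShaHat

/-- The homomorphism from the completion to the sequences, `Φ̂` in the theorem. -/
def toStdSeq : ShaHat lam C →ₗ[C] StdSeq C C := binomSeqHom lam ∘ₗ (coeffs lam).toLinearMap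

theorem toStdSeq_shaHatSum (b : ℕ → C) : toStdSeq lam (shaHatSum lam b) = binomSeq lam b :=
  congr_arg (binomSeq lam) (coeffs_shaHatSum lam b)

theorem toStdSeq_injective {lam : C} (hlam : IsLeftRegular lam) :
    Function.Injective (toStdSeq lam) :=
  (binomSeqHom_injective hlam).comp (coeffs lam).injective

theorem toStdSeq_congr {x y : ShaHat lam C} {n : ℕ+} (h : ∀ i < (n : ℕ), x i = y i) :
    toStdSeq lam x n = toStdSeq lam y n := by
  refine congr_arg (algebraMap C (Bar C C)) (sum_congr rfl fun i hi => ?_)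
  exact congr_arg (fun z => _ * TPow.selfEquiv (i + 1) z) (h i (mem_range.1 hi))

theorem toStdSeq_op (x : ShaHat lam C) :
    toStdSeq lam (op lam C x) = stdOp C lam (toStdSeq lam x) := by
  obtain ⟨b, rfl⟩ := (shaHatSum_bijective lam).2 x
  let shift : ℕ → C
    | 0 => 0
    | i + 1 => b i
  have hop : op lam C (shaHatSum lam b) = shaHatSum lam shift := by
    rw [shaHatSum_eq lam shift, show shift 0 = 0 from rfl, zero_smul, zero_add]
  have hstd : stdOp C lam (binomSeq lam b) = binomSeq lam shift := by
    rw [binomSeq_eq lam shift, show shift 0 = 0 from rfl, zero_smul, zero_add]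
  rw [hop, toStdSeq_shaHatSum, toStdSeq_shaHatSum, hstd]

end ShaHat

namespace Sha

/-- The homomorphism from the shuffle Baxter algebra to the sequences, `Φ` in the theorem. -/
def toStdSeq : Sha lam C →ₗ[C] StdSeq C C := ShaHat.toStdSeq lam ∘ₗ ShaHat.ofSha lam C

theorem toStdSeq_apply (x : Sha lam C) :
    toStdSeq lam x = ShaHat.toStdSeq lam (ShaHat.ofSha lam C x) := rfl

theorem toStdSeq_shaSum (b : ℕ →₀ C) : toStdSeq lam (shaSum lam b) = binomSeq lam b := by
  rw [toStdSeq_apply, ShaHat.ofSha_shaSum, ShaHat.toStdSeq_shaHatSum]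

theorem toStdSeq_injective {lam : C} (hlam : IsLeftRegular lam) :
    Function.Injective (toStdSeq lam) :=
  (ShaHat.toStdSeq_injective hlam).comp ShaHat.ofSha_injective

theorem toStdSeq_ones (m : ℕ) (n : ℕ+) :
    toStdSeq lam (ones lam m) n =
      algebraMap C (Bar C C) (((n : ℕ) - 1).choose m * lam ^ m) := by
  rw [toStdSeq_apply, ShaHat.ofSha_ones, ShaHat.toStdSeq_shaHatSum, binomSeq_apply,
    binomSum_single]

theorem toStdSeq_one : toStdSeq lam 1 = 1 := by
  funext n
  rw [one_eq_ones_zero, toStdSeq_ones, Nat.choose_zero_right, Nat.cast_one, pow_zero, mul_one,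
    map_one, Pi.one_apply]

theorem toStdSeq_j (a : C) : toStdSeq lam (j lam C a) = tSeq C a := by
  rw [j_eq_smul_one, map_smul, toStdSeq_one, tSeq_eq_smul_one]

theorem toStdSeq_op (x : Sha lam C) : toStdSeq lam (op lam C x) = stdOp C lam (toStdSeq lam x) := by
  rw [toStdSeq_apply, ← ShaHat.op_ofSha, ShaHat.toStdSeq_op, ← toStdSeq_apply]

theorem toStdSeq_ones_mul_ones (m n : ℕ) :
    toStdSeq lam (ones lam m * ones lam n) =
      toStdSeq lam (ones lam m) * toStdSeq lam (ones lam n) := by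
  funext N
  have term (s : MixableShuffle m n) :
      (lam ^ #s.merged • toStdSeq lam (ones lam (m + n - #s.merged))) N = algebraMap C (Bar C C)
        (((N : ℕ) - 1).choose (m + n - #s.merged) * lam ^ (m + n)) := by
    have hle := s.card_merged_le_left
    rw [Pi.smul_apply, toStdSeq_ones, Algebra.smul_def, ← map_mul, mul_left_comm, ← pow_add,
      Nat.add_sub_cancel' (by omega)]
  calc toStdSeq lam (ones lam m * ones lam n) N
      = ∑ s : MixableShuffle m n, algebraMap C (Bar C C)
          (((N : ℕ) - 1).choose (m + n - #s.merged) * lam ^ (m + n)) := by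
        rw [ones_mul_ones, map_sum, Finset.sum_apply]
        simp only [map_smul, term]
    _ = algebraMap C (Bar C C)
          ((((N : ℕ) - 1).choose m * ((N : ℕ) - 1).choose n : ℕ) * lam ^ (m + n)) := by
        rw [← map_sum, ← sum_mul, ← Nat.cast_sum, MixableShuffle.sum_choose]
    _ = (toStdSeq lam (ones lam m) * toStdSeq lam (ones lam n)) N := by
        rw [Pi.mul_apply, toStdSeq_ones, toStdSeq_ones, ← map_mul, Nat.cast_mul, pow_add,
          mul_mul_mul_comm]

theorem toStdSeq_mul (x y : Sha lam C) :
    toStdSeq lam (x * y) = toStdSeq lam x * toStdSeq lam y := by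
  have bilinear : (mul lam C).compr₂ (toStdSeq lam) =
      (LinearMap.mul C (StdSeq C C)).compl₁₂ (toStdSeq lam) (toStdSeq lam) :=
    linearMap_ext_ones fun m => linearMap_ext_ones fun n => toStdSeq_ones_mul_ones lam m n
  exact LinearMap.congr_fun₂ bilinear x y

theorem isBaxterHom_toStdSeq : IsBaxterHom (op lam C) (stdOp C lam) (toStdSeq lam) where
  map_one := toStdSeq_one lam
  map_mul := toStdSeq_mul lam
  map_op := toStdSeq_op lam

end Sha

namespace ShaHat

theorem toStdSeq_mul (x y : ShaHat lam C) :
    toStdSeq lam (x * y) = toStdSeq lam x * toStdSeq lam y := by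
  funext n
  have toStdSeq_trunc (z : ShaHat lam C) :
      Sha.toStdSeq lam (trunc lam C n z) n = toStdSeq lam z n :=
    toStdSeq_congr lam fun i hi => ofSha_trunc_of_le hi.le z
  rw [Pi.mul_apply, ← toStdSeq_trunc x, ← toStdSeq_trunc y, ← Pi.mul_apply, ← Sha.toStdSeq_mul]
  exact toStdSeq_congr lam fun i hi => mul_apply_of_le hi.le x y

theorem isBaxterHom_toStdSeq : IsBaxterHom (op lam C) (stdOp C lam) (toStdSeq lam) where
  map_one := Sha.toStdSeq_one lam
  map_mul := toStdSeq_mul lam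
  map_op := toStdSeq_op lam

end ShaHat

namespace Sha

theorem range_toStdSeq_le : LinearMap.range (toStdSeq lam) ≤ (Std C lam).toSubmodule := by
  rw [LinearMap.range_eq_map, ← span_range_ones lam, Submodule.map_span_le]
  rintro _ ⟨n, rfl⟩
  induction n with
  | zero =>
    rw [← one_eq_ones_zero, toStdSeq_one]
    exact one_mem (Std C lam)
  | succ n ih =>
    rw [← op_ones, toStdSeq_op]
    exact stdOp_mem C lam _ ih

theorem std_le_range_toStdSeq : (Std C lam).toSubmodule ≤ LinearMap.range (toStdSeq lam) := by
  let image : Subalgebra C (StdSeq C C) :=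
    (LinearMap.range (toStdSeq lam)).toSubalgebra ⟨1, toStdSeq_one lam⟩ <| by
      rintro _ _ ⟨x, rfl⟩ ⟨y, rfl⟩
      exact ⟨x * y, toStdSeq_mul lam x y⟩
  have std_le_image : Std C lam ≤ image := by
    refine sInf_le ⟨fun a => ⟨j lam C a, toStdSeq_j lam a⟩, ?_⟩
    rintro _ ⟨x, rfl⟩
    exact ⟨op lam C x, toStdSeq_op lam x⟩
  exact std_le_image

variable {lam}

/-- The isomorphism `Φ : Ш_C(C) ≃ 𝔖(C)`. -/
def equivStd (hlam : IsLeftRegular lam) : Sha lam C ≃ₗ[C] Std C lam :=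
  (LinearEquiv.ofInjective (toStdSeq lam) (toStdSeq_injective hlam)).trans
    (LinearEquiv.ofEq _ (Std C lam).toSubmodule
      ((range_toStdSeq_le lam).antisymm (std_le_range_toStdSeq lam)))

theorem isBaxterHom_equivStd (hlam : IsLeftRegular lam) :
    IsBaxterHom (op lam C) (Std.op C lam) (equivStd hlam : Sha lam C →ₗ[C] Std C lam) where
  map_one := Subtype.ext (toStdSeq_one lam)
  map_mul x y := Subtype.ext (toStdSeq_mul lam x y)
  map_op x := Subtype.ext (toStdSeq_op lam x)

end Sha

end Base

end FreeBaxter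

end

open FreeBaxter in
theorem mainTheorem11_general {C : Type*} [CommRing C] (lam : C) (hlam : IsLeftRegular lam) :
    Function.Bijective (algebraMap C (Bar C C)) ∧
    Function.Bijective (shaSum lam) ∧
    Function.Bijective (shaHatSum lam) ∧
    ∃ Φ : Sha lam C ≃ₗ[C] Std C lam,
      (IsBaxterHom (Sha.op lam C) (Std.op C lam) (Φ : Sha lam C →ₗ[C] Std C lam) ∧
        ∀ a : C, (Φ (Sha.j lam C a) : StdSeq C C) = tSeq C a) ∧
      (∀ Ψ : Sha lam C →ₗ[C] Std C lam, IsBaxterHom (Sha.op lam C) (Std.op C lam) Ψ →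
        (∀ a : C, (Ψ (Sha.j lam C a) : StdSeq C C) = tSeq C a) → Ψ = Φ) ∧
      (∀ b : ℕ →₀ C, (Φ (shaSum lam b) : StdSeq C C) = binomSeq lam b) ∧
      ∃ Φhat : ShaHat lam C →ₗ[C] StdSeq C C,
        (IsBaxterHom (ShaHat.op lam C) (stdOp C lam) Φhat ∧
          (∀ x : Sha lam C, Φhat (ShaHat.ofSha lam C x) = Φ x) ∧
          Function.Injective Φhat) ∧
        (∀ Ψ : ShaHat lam C →ₗ[C] StdSeq C C,
          IsBaxterHom (ShaHat.op lam C) (stdOp C lam) Ψ →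
          (∀ x : Sha lam C, Ψ (ShaHat.ofSha lam C x) = Φ x) → Ψ = Φhat) ∧
        ∀ b : ℕ → C, Φhat (shaHatSum lam b) = binomSeq lam b := by
  have hΦ := Sha.isBaxterHom_equivStd hlam
  have hΦhat := ShaHat.isBaxterHom_toStdSeq lam
  refine ⟨Bar.algebraMap_bijective, shaSum_bijective lam, shaHatSum_bijective lam,
    Sha.equivStd hlam, ⟨hΦ, Sha.toStdSeq_j lam⟩, fun Ψ hΨ _ => ?_, Sha.toStdSeq_shaSum lam,
    ShaHat.toStdSeq lam, ⟨hΦhat, fun _ => rfl, ShaHat.toStdSeq_injective hlam⟩,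
    fun Ψ hΨ _ => ?_, ShaHat.toStdSeq_shaHatSum lam⟩
  · exact Sha.linearMap_ext_of_map_op hΨ.map_op hΦ.map_op (hΨ.map_one.trans hΦ.map_one.symm)
  · exact ShaHat.linearMap_ext_of_map_op hΨ.map_op hΦhat.map_op
      (hΨ.map_one.trans hΦhat.map_one.symm)

theorem mainTheorem11 {C : Type*} [CommRing C] [IsDomain C] (lam : C) (hlam : lam ≠ 0) :
    Function.Bijective (algebraMap C (FreeBaxter.Bar C C)) ∧
    Function.Bijective (FreeBaxter.shaSum lam) ∧
    Function.Bijective (FreeBaxter.shaHatSum lam) ∧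
    ∃ Φ : FreeBaxter.Sha lam C ≃ₗ[C] FreeBaxter.Std C lam,
      -- `Φ` is the unique Baxter algebra homomorphism that sends each `a` to `t^{(a)}`
      (FreeBaxter.IsBaxterHom (FreeBaxter.Sha.op lam C) (FreeBaxter.Std.op C lam)
          (Φ : FreeBaxter.Sha lam C →ₗ[C] FreeBaxter.Std C lam) ∧
        ∀ a : C, (Φ (FreeBaxter.Sha.j lam C a) : FreeBaxter.StdSeq C C) =
          FreeBaxter.tSeq C a) ∧
      (∀ Ψ : FreeBaxter.Sha lam C →ₗ[C] FreeBaxter.Std C lam,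
        FreeBaxter.IsBaxterHom (FreeBaxter.Sha.op lam C) (FreeBaxter.Std.op C lam) Ψ →
        (∀ a : C, (Ψ (FreeBaxter.Sha.j lam C a) : FreeBaxter.StdSeq C C) =
          FreeBaxter.tSeq C a) →
        Ψ = Φ) ∧
      (∀ b : ℕ →₀ C, (Φ (FreeBaxter.shaSum lam b) : FreeBaxter.StdSeq C C) =
        FreeBaxter.binomSeq lam b) ∧
      ∃ Φhat : FreeBaxter.ShaHat lam C →ₗ[C] FreeBaxter.StdSeq C C,
        -- `Φhat` is the unique Baxter algebra homomorphism extending `Φ`, and it is injective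
        (FreeBaxter.IsBaxterHom (FreeBaxter.ShaHat.op lam C) (FreeBaxter.stdOp C lam) Φhat ∧
          (∀ x : FreeBaxter.Sha lam C, Φhat (FreeBaxter.ShaHat.ofSha lam C x) = Φ x) ∧
          Function.Injective Φhat) ∧
        (∀ Ψ : FreeBaxter.ShaHat lam C →ₗ[C] FreeBaxter.StdSeq C C,
          FreeBaxter.IsBaxterHom (FreeBaxter.ShaHat.op lam C) (FreeBaxter.stdOp C lam) Ψ →
          (∀ x : FreeBaxter.Sha lam C, Ψ (FreeBaxter.ShaHat.ofSha lam C x) = Φ x) →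
          Ψ = Φhat) ∧
        ∀ b : ℕ → C, Φhat (FreeBaxter.shaHatSum lam b) = FreeBaxter.binomSeq lam b := by
  exact mainTheorem11_general lam (IsRegular.of_ne_zero hlam).left
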